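/- Let $\mathscr M$ be a von Neumann algebra acting on a complex Hilbert space, and suppose that $\mathscr M$ has no direct summand of type $\mathrm I_1$, i.e., there is no nonzero central projection $Z\in\mathscr M$ such that $\mathscr MZ$ is abelian. For $A\in\mathscr M$ let $\mathcal R(A)$ denote its range projection, i.e., the orthogonal projection onto the closure of the range of $A$. Let $\Phi\colon\mathscr M\to\mathscr M$ be a bijective map (not assumed linear or continuous) such that (i) $\Phi$ is ortho-additive: $\Phi(A+B)=\Phi(A)+\Phi(B)$ for all $A,B\in\mathscr M$ with $A^*B=0$; (ii) $\Phi$ is range-expansive: $\mathcal R(A)\leqslant\mathcal R(\Phi(A))$ for all $A\in\mathscr M$. Then $\Phi(A)=A\,\Phi(I)$ for every $A\in\mathscr M$, and $\Phi(I)$ is invertible in $\mathscr M$. -/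

import Mathlib

namespace VonNeumannAlgebra

variable {H : Type*} [NormedAddCommGroup H] [InnerProductSpace ℂ H] [CompleteSpace H]

/-- The range projection of a bounded operator: the orthogonal projection of `H` onto the closure
of the range of `A`. -/
noncomputable def rangeProj (A : H →L[ℂ] H) : H →L[ℂ] H :=
  (LinearMap.range (A : H →ₗ[ℂ] H)).topologicalClosure.starProjection

/-- Two elements `A`, `B` of a von Neumann algebra are orthogonal if `A* B = 0`. -/
def Ortho {M : VonNeumannAlgebra H} (A B : M) : Prop :=
  star A * B = 0

/-- `Φ` is additive on orthogonal pairs. -/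
def IsOrthoAdditive {M : VonNeumannAlgebra H} (Φ : M → M) : Prop :=
  ∀ A B : M, Ortho A B → Φ (A + B) = Φ A + Φ B

/-- `R(A) ≤ R(Φ(A))` for all `A`, in the usual (Loewner) order of projections. -/
def IsRangeExpansive {M : VonNeumannAlgebra H} (Φ : M → M) : Prop :=
  ∀ A : M, rangeProj (A : H →L[ℂ] H) ≤ rangeProj (Φ A : H →L[ℂ] H)

/-- `P` is an abelian projection of `M`: a projection such that `P M P` is abelian. -/
def IsAbelianProj {M : VonNeumannAlgebra H} (P : M) : Prop :=
  IsStarProjection P ∧ ∀ A B : M, Commute (P * A * P) (P * B * P)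

/-- Murray-von Neumann equivalence of projections in `M`. -/
def MvNEquiv {M : VonNeumannAlgebra H} (P Q : M) : Prop :=
  ∃ V : M, star V * V = P ∧ V * star V = Q

/-- `Z` is a nonzero central projection of `M`, so that `M Z` is a (nonzero) direct summand of `M`,
and `M Z` is of type `I_n`: its identity `Z` is the sum of `n` mutually orthogonal, equivalent
abelian projections. (For projections below the central projection `Z`, being abelian or equivalent
means the same in `M Z` as in `M`.) -/
def IsTypeISummand (M : VonNeumannAlgebra H) (n : ℕ) (Z : M) : Prop :=
  IsStarProjection Z ∧ Z ∈ Set.center M ∧ Z ≠ 0 ∧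
    ∃ P : Fin n → M, (∀ j, IsAbelianProj (P j)) ∧ (∀ i j, i ≠ j → Ortho (P i) (P j)) ∧
      (∀ i j, MvNEquiv (P i) (P j)) ∧ ∑ j, P j = Z

/-- `M` has a direct summand of type `I_n`. -/
def HasTypeISummand (M : VonNeumannAlgebra H) (n : ℕ) : Prop :=
  ∃ Z : M, IsTypeISummand M n Z

end VonNeumannAlgebra

/-!
The inverse of `Φ` does not enlarge range projections, so it preserves orthogonality and is itself
ortho-additive. Applied to the orthogonal decomposition `A = P A + (1 - P) A` this gives
`Φ (P A) = P (Φ A)` for every projection `P` of `M`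
(`VonNeumannAlgebra.mem_leftMultipliers_of_isStarProjection`), and the rest of the argument uses
only this identity.

Let `G` be the multiplicative monoid of all `T` with `Φ (T A) = T (Φ A)` for all `A`. If
`X = P X (1 - P)`, then the projection onto the graph of `X*` on the range of `P` lies in `G`; its
corners with respect to `P` involve only `(1 + X X*)⁻¹` and `X`, and inverting the former shows that
`P + X` and `X` lie in `G` (`add_mem_leftMultipliers`). Hence `Φ (P A + X C) = P (Φ A) + X (Φ C)`,
which says that every such off-diagonal `X` annihilates the additivity defect
`D = Φ (A + C) - Φ A - Φ C` from the left.

Such a `D` vanishes. The vectors killed by all `[P, T]`, with `P` a projection of `M` and `T` in `M`,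
form a closed subspace `K` containing the range of `D`, because `[P, T]` is a difference of
off-diagonal corners. By `[P, T] R = [P, T R] - T [P, R]` it is invariant under `M`, and it is
invariant under the commutant, so the projection `Z` onto it is central. Since projections span `M`
densely, `M Z` is abelian, and the absence of an abelian summand forces `K = 0`
(`VonNeumannAlgebra.projectionCommutatorKer_eq_bot`). Thus `Φ` is additive, and the same vanishing
applied to `Φ (S A) - S (Φ A)` gives left `M`-linearity, i.e. `Φ A = A (Φ 1)`. Bijectivity makes
`Φ 1` invertible.

The density of the span of projections is proved by halving: a self-adjoint `T` of norm at most `r`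
is within `r / 2` of `(r / 2) (2E - 1)`, where `E` is the range projection of `|T| + T`
(`VonNeumannAlgebra.exists_isStarProjection_norm_sub_le`).
-/

/-! ### Self-maps of a star ring that commute with left multiplication by projections -/

section StarRing

variable {R : Type*} [Ring R] [StarRing R]

/-- The elements `t` of a ring such that `f` commutes with left multiplication by `t`. -/
def leftMultipliers (f : R → R) : Submonoid R where
  carrier := {t | ∀ a, f (t * a) = t * f a}
  one_mem' a := by simp
  mul_mem' {s t} hs ht a := by
    rw [mul_assoc, hs, ht, mul_assoc]

/-- If `x = p x (1 - p)`, the projection onto the graph of `x* : pH → (1 - p)H` is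
`(p + x)* h⁻¹ (p + x)` with `h = 1 + x x*`. Its corners cut out by `p` yield `h⁻¹ p` and
`h⁻¹ (p + x)` as left multipliers, hence also `p + x` itself. -/
theorem add_mem_leftMultipliers (hunit : ∀ x : R, IsUnit (1 + x * star x)) {f : R → R}
    (hf : ∀ p, IsStarProjection p → p ∈ leftMultipliers f) {p x : R} (hp : IsStarProjection p)
    (hpx : p * x = x) (hxp : x * p = 0) : p + x ∈ leftMultipliers f := by
  have hpp : p * p = p := hp.isIdempotentElem
  have hps : star p = p := hp.isSelfAdjoint
  have hsx : star x * p = star x := by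
    simpa [hps] using congrArg star hpx
  have hps0 : p * star x = 0 := by
    simpa [hps] using congrArg star hxp
  obtain ⟨h, hh⟩ := hunit x
  set k : R := ((h⁻¹ : Rˣ) : R) with hk
  have hkh : k * (1 + x * star x) = 1 := by rw [← hh, hk, Units.inv_mul]
  have hhk : (1 + x * star x) * k = 1 := by rw [← hh, hk, Units.mul_inv]
  have hph : Commute p (h : R) := by
    rw [hh, commute_iff_eq]
    simp only [mul_add, add_mul, mul_one, one_mul, ← mul_assoc, hpx]
    rw [mul_assoc x, hsx]
  have hpk : p * k = k * p := hph.units_inv_right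
  have hks : star k = k := by
    have h1 : star k * (1 + x * star x) = 1 := by simpa using congrArg star hhk
    calc star k = star k * ((1 + x * star x) * k) := by rw [hhk, mul_one]
      _ = k := by rw [← mul_assoc, h1, one_mul]
  have hpv : p * (p + x) = p + x := by rw [mul_add, hpp, hpx]
  have hvv : (p + x) * (p + star x) = (1 + x * star x) * p := by
    simp only [mul_add, add_mul, hpp, hxp, hps0, one_mul, mul_assoc, hsx]
    abel
  have hpvs : p * (p + star x) = p := by rw [mul_add, hpp, hps0, add_zero]
  have hq : IsStarProjection ((p + star x) * (k * (p + x))) := by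
    constructor
    · change _ * _ = _
      calc (p + star x) * (k * (p + x)) * ((p + star x) * (k * (p + x)))
          = (p + star x) * (k * ((p + x) * (p + star x)) * (k * (p + x))) := by
            simp only [mul_assoc]
        _ = (p + star x) * (k * (1 + x * star x) * (p * k) * (p + x)) := by
            rw [hvv]; simp only [mul_assoc]
        _ = (p + star x) * (k * (p * (p + x))) := by
            rw [hkh, hpk]; simp only [mul_assoc, one_mul]
        _ = _ := by rw [hpv]
    · change star _ = _
      simp [hks, hps, mul_assoc]
  have hpq : p * ((p + star x) * (k * (p + x))) = k * (p + x) := by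
    rw [← mul_assoc, hpvs, ← mul_assoc, hpk, mul_assoc, hpv]
  have hkv : k * (p + x) ∈ leftMultipliers f := by
    rw [← hpq]
    exact mul_mem (hf p hp) (hf _ hq)
  have hkp : k * p ∈ leftMultipliers f := by
    have := mul_mem hkv (hf p hp)
    rwa [mul_assoc, add_mul, hpp, hxp, add_zero] at this
  have hhp : p * (1 + x * star x) ∈ leftMultipliers f := by
    intro a
    -- `f` is compared at `p a = (k p) (p h a)`, with `k p` a left multiplier.
    have h1 : k * p * (p * (1 + x * star x) * a) = p * a := by
      have : k * p * (p * (1 + x * star x)) = p := by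
        rw [mul_assoc, ← mul_assoc p p, hpp, ← mul_assoc, ← hpk, mul_assoc, hkh, mul_one]
      rw [← mul_assoc, this]
    have h2 := hkp (p * (1 + x * star x) * a)
    rw [h1, hf p hp a] at h2
    have h3 : p * f (p * (1 + x * star x) * a) = f (p * (1 + x * star x) * a) := by
      rw [← hf p hp, ← mul_assoc, ← mul_assoc, hpp]
    rw [mul_assoc, h3] at h2
    have hph' : p * (1 + x * star x) = (1 + x * star x) * p := by rw [← hh]; exact hph
    rw [hph', mul_assoc _ p (f a), h2, ← hph', ← mul_assoc (1 + x * star x), hhk, one_mul]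
  have := mul_mem hhp hkv
  rwa [mul_assoc, ← mul_assoc _ k, hhk, one_mul, hpv] at this

theorem map_add_of_isStarProjection {f : R → R}
    (hf : ∀ p, IsStarProjection p → p ∈ leftMultipliers f) {p : R} (hp : IsStarProjection p)
    (a c : R) : f (p * a + (1 - p) * c) = p * f a + (1 - p) * f c := by
  have hpp : p * p = p := hp.isIdempotentElem
  have h1 : p * f (p * a + (1 - p) * c) = p * f a := by
    rw [← hf p hp, ← hf p hp, mul_add, ← mul_assoc, ← mul_assoc, mul_sub, hpp]
    simp
  have h2 : (1 - p) * f (p * a + (1 - p) * c) = (1 - p) * f c := by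
    rw [← hf _ hp.one_sub, ← hf _ hp.one_sub, mul_add, ← mul_assoc, ← mul_assoc,
      hp.one_sub.isIdempotentElem.eq, sub_mul, hpp]
    simp
  rw [← h1, ← h2, ← add_mul, add_sub_cancel, one_mul]

/-- The hypothesis `hnd` says that the off-diagonal corners `p R (1 - p)` have no common right
annihilator. It is used to test identities after left multiplication by such corners, where
everything takes place inside the graph multipliers of `add_mem_leftMultipliers`. -/
theorem eq_mul_map_one_of_isStarProjection_mem_leftMultipliers
    (hunit : ∀ x : R, IsUnit (1 + x * star x))
    (hnd : ∀ d : R, (∀ p x : R, IsStarProjection p → p * x = x → x * p = 0 → x * d = 0) → d = 0)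
    {f : R → R} (hf : ∀ p, IsStarProjection p → p ∈ leftMultipliers f) (a : R) :
    f a = a * f 1 := by
  have hx : ∀ p x : R, IsStarProjection p → p * x = x → x * p = 0 → x ∈ leftMultipliers f := by
    intro p x hp hpx hxp
    have := mul_mem (add_mem_leftMultipliers hunit hf hp hpx hxp) (hf _ hp.one_sub)
    rwa [add_mul, mul_sub, mul_sub, hxp, hp.isIdempotentElem.eq, mul_one, mul_one, sub_self,
      zero_add, sub_zero] at this
  have hadd : ∀ a c, f (a + c) = f a + f c := by
    intro a c
    have := hnd (f (a + c) - (f a + f c)) fun p x hp hpx hxp => by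
      have hxm := hx p x hp hpx hxp
      have h1 : x * a + x * c = (p + x) * (p * (x * a) + (1 - p) * c) := by
        have hpp : p * p = p := hp.isIdempotentElem
        have e1 : (p + x) * p = p := by rw [add_mul, hpp, hxp, add_zero]
        have e2 : (p + x) * (1 - p) = x := by rw [mul_sub, e1]; simp
        rw [mul_add, ← mul_assoc _ p, ← mul_assoc _ (1 - p), e1, e2, ← mul_assoc p, hpx]
      have h2 : (p + x) * (p * f (x * a) + (1 - p) * f c) = x * f a + x * f c := by
        have hpp : p * p = p := hp.isIdempotentElem
        have e1 : (p + x) * p = p := by rw [add_mul, hpp, hxp, add_zero]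
        have e2 : (p + x) * (1 - p) = x := by rw [mul_sub, e1]; simp
        rw [mul_add, ← mul_assoc _ p, ← mul_assoc _ (1 - p), e1, e2, hxm, ← mul_assoc p, hpx]
      have h3 : f (x * a + x * c) = x * f a + x * f c := by
        rw [h1, add_mem_leftMultipliers hunit hf hp hpx hxp, map_add_of_isStarProjection hf hp, h2]
      rw [mul_sub, ← hxm, mul_add, h3, mul_add, sub_self]
    exact sub_eq_zero.mp this
  have hall : ∀ s, s ∈ leftMultipliers f := by
    intro s b
    have := hnd (f (s * b) - s * f b) fun p x hp hpx hxp => by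
      have hxm := hx p x hp hpx hxp
      have hpp : p * p = p := hp.isIdempotentElem
      -- `x s` splits into `x ((1 - p) s p)` and `x s (1 - p)`, made of off-diagonal corners.
      have m1 : (1 - p) * s * p ∈ leftMultipliers f :=
        hx (1 - p) _ hp.one_sub
          (by rw [← mul_assoc, ← mul_assoc, hp.one_sub.isIdempotentElem.eq])
          (by rw [mul_assoc, mul_sub, hpp]; simp)
      have m2 : x * s * (1 - p) ∈ leftMultipliers f :=
        hx p _ hp (by rw [← mul_assoc, ← mul_assoc, hpx]) (by rw [mul_assoc, sub_mul, hpp]; simp)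
      have hs : x * s = x * ((1 - p) * s * p) + x * s * (1 - p) := by
        have : x * (1 - p) = x := by rw [mul_sub, hxp]; simp
        rw [← mul_assoc, ← mul_assoc, this, mul_sub]; simp
      rw [mul_sub, ← hxm, ← mul_assoc, ← mul_assoc, hs, add_mul, hadd, mul_mem hxm m1, m2, add_mul,
        sub_self]
    exact sub_eq_zero.mp this
  simpa using hall a 1

end StarRing

namespace VonNeumannAlgebra

variable {H : Type*} [NormedAddCommGroup H] [InnerProductSpace ℂ H] [CompleteSpace H]

/-! ### Membership in a von Neumann algebra -/

theorem mem_of_forall_commute {M : VonNeumannAlgebra H} {T : H →L[ℂ] H}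
    (hT : ∀ C ∈ M.commutant, Commute C T) : T ∈ M := by
  rw [← M.commutant_commutant, mem_commutant_iff]
  exact hT

theorem commute_of_mem_commutant {M : VonNeumannAlgebra H} {T C : H →L[ℂ] H}
    (hC : C ∈ M.commutant) (hT : T ∈ M) : Commute C T :=
  (mem_commutant_iff.mp hC T hT).symm

theorem smul_mem (M : VonNeumannAlgebra H) (c : ℂ) {T : H →L[ℂ] H} (hT : T ∈ M) : c • T ∈ M :=
  M.toStarSubalgebra.smul_mem hT c

theorem real_smul_mem (M : VonNeumannAlgebra H) (c : ℝ) {T : H →L[ℂ] H} (hT : T ∈ M) :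
    c • T ∈ M := by
  rw [← Complex.coe_smul]
  exact smul_mem M c hT

theorem isUnit_coe {M : VonNeumannAlgebra H} {x : M} (hx : IsUnit (x : H →L[ℂ] H)) : IsUnit x := by
  obtain ⟨u, hu⟩ := hx
  have hmem : ((u⁻¹ : (H →L[ℂ] H)ˣ) : H →L[ℂ] H) ∈ M := mem_of_forall_commute fun C hC =>
    Commute.units_inv_right (by rw [hu]; exact commute_of_mem_commutant hC x.2)
  exact ⟨⟨x, ⟨_, hmem⟩, Subtype.ext (by simp [← hu]), Subtype.ext (by simp [← hu])⟩, rfl⟩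

theorem isUnit_one_add_mul_star {M : VonNeumannAlgebra H} (x : M) : IsUnit (1 + x * star x) := by
  apply isUnit_coe
  refine CStarAlgebra.isUnit_of_le (1 : H →L[ℂ] H) ?_
  have : (0 : H →L[ℂ] H) ≤ x * star (x : H →L[ℂ] H) := mul_star_self_nonneg _
  simp [this]

theorem starProjection_mem {M : VonNeumannAlgebra H} (K : Submodule ℂ H)
    [K.HasOrthogonalProjection] (hK : ∀ C ∈ M.commutant, ∀ ξ ∈ K, C ξ ∈ K) :
    K.starProjection ∈ M := by
  rw [IsStarProjection.mem_iff isStarProjection_starProjection]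
  intro C hC
  rw [Submodule.range_starProjection]
  exact hK C hC

/-! ### Range projections -/

theorem isStarProjection_rangeProj (A : H →L[ℂ] H) : IsStarProjection (rangeProj A) :=
  isStarProjection_starProjection

theorem rangeProj_mem {M : VonNeumannAlgebra H} {A : H →L[ℂ] H} (hA : A ∈ M) :
    rangeProj A ∈ M := by
  refine starProjection_mem _ fun C hC ξ hξ => ?_
  have hmaps : Set.MapsTo C (LinearMap.range (A : H →ₗ[ℂ] H) : Set H)
      (LinearMap.range (A : H →ₗ[ℂ] H) : Set H) := by
    rintro _ ⟨η, rfl⟩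
    exact ⟨C η, by simpa using! (congr($((commute_of_mem_commutant hC hA).eq) η)).symm⟩
  exact hmaps.closure C.continuous hξ

theorem rangeProj_mul_self (A : H →L[ℂ] H) : rangeProj A * A = A := by
  ext ξ
  exact Submodule.starProjection_eq_self_iff.mpr
    (Submodule.le_topologicalClosure _ (LinearMap.mem_range_self _ ξ))

theorem mul_rangeProj_eq_zero_iff {A B : H →L[ℂ] H} : B * rangeProj A = 0 ↔ B * A = 0 := by
  constructor
  · intro h
    rw [← rangeProj_mul_self A, ← mul_assoc, h, zero_mul]
  · intro h
    have hle : (LinearMap.range (A : H →ₗ[ℂ] H)).topologicalClosure ≤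
        LinearMap.ker B.toLinearMap := by
      refine Submodule.topologicalClosure_minimal _ ?_ B.isClosed_ker
      rintro _ ⟨η, rfl⟩
      simpa using! congr($h η)
    ext ξ
    exact hle (Submodule.starProjection_apply_mem _ ξ)

theorem mul_eq_zero_of_rangeProj_le {A A' B : H →L[ℂ] H} (h : rangeProj A ≤ rangeProj A')
    (hB : B * A' = 0) : B * A = 0 := by
  rw [← mul_rangeProj_eq_zero_iff] at hB ⊢
  have h' : rangeProj A' * rangeProj A = rangeProj A := by
    unfold rangeProj at h ⊢
    rw [Submodule.starProjection_le_starProjection_iff] at h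
    ext ξ
    exact Submodule.starProjection_eq_self_iff.mpr (h (Submodule.starProjection_apply_mem _ ξ))
  rw [← h', ← mul_assoc, hB, zero_mul]

/-! ### Approximation by projections -/

/-- If `E` is the range projection of `|T| + T`, then `|T| (2E - 1) = T`, so that
`T - (r / 2) (2E - 1) = (|T| - r / 2) (2E - 1)`. -/
theorem exists_isStarProjection_norm_sub_le {M : VonNeumannAlgebra H} {T : H →L[ℂ] H} (hT : T ∈ M)
    (hsa : IsSelfAdjoint T) {r : ℝ} (hr : ‖T‖ ≤ r) :
    ∃ E ∈ M, IsStarProjection E ∧ ‖T - (r / 2) • (2 * E - 1)‖ ≤ r / 2 := by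
  set N : H →L[ℂ] H := cfc (fun x : ℝ => |x|) T with hN
  have hNM : N ∈ M := mem_of_forall_commute fun C hC =>
    ((commute_of_mem_commutant hC hT).symm.cfc_real _).symm
  have hNT : Commute N T := (Commute.refl T).cfc_real _
  have hNsa : IsSelfAdjoint N := cfc_predicate _ _
  have hNN : N * N = T * T := by
    have hid : cfc (fun x : ℝ => x * x) T = T * T := by
      rw [cfc_mul .., cfc_id' ℝ T]
    rw [hN, ← cfc_mul .., ← hid]
    simp only [abs_mul_abs_self]
  set E := rangeProj (N + T) with hE
  have hEp : IsStarProjection E := isStarProjection_rangeProj _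
  have hEM : E ∈ M := rangeProj_mem (add_mem hNM hT)
  have h1 : (N + T) * E = N + T := by
    have := congrArg star (rangeProj_mul_self (N + T))
    simpa only [star_mul, (hNsa.add hsa).star_eq, ← hE, hEp.isSelfAdjoint.star_eq] using this
  have h2 : (N - T) * E = 0 := by
    rw [hE, mul_rangeProj_eq_zero_iff]
    rw [sub_mul, mul_add, mul_add, hNN, hNT.eq]
    abel
  have h3 : N * (2 * E - 1) = T := by
    have : N * (2 * E - 1) = (N + T) * E + (N - T) * E - N := by
      noncomm_ring
    rw [this, h1, h2]
    abel
  have h4 : T - (r / 2) • (2 * E - 1) = (N - algebraMap ℝ _ (r / 2)) * (2 * E - 1) := by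
    rw [sub_mul, h3, Algebra.smul_def]
  refine ⟨E, hEM, hEp, ?_⟩
  have h5 : N - algebraMap ℝ _ (r / 2) = cfc (fun x : ℝ => |x| - r / 2) T := by
    rw [cfc_sub .., cfc_const ..]
  have hr0 : 0 ≤ r := (norm_nonneg T).trans hr
  have h6 : ‖N - algebraMap ℝ _ (r / 2)‖ ≤ r / 2 := by
    rw [h5]
    refine norm_cfc_le (by positivity) fun x hx => ?_
    have hx' : |x| ≤ r := calc
      |x| ≤ ‖T‖ * ‖(1 : H →L[ℂ] H)‖ := spectrum.norm_le_norm_mul_of_mem hx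
      _ ≤ ‖T‖ * 1 := by gcongr; exact ContinuousLinearMap.norm_id_le
      _ ≤ r := by rwa [mul_one]
    rw [Real.norm_eq_abs, abs_le]
    constructor <;> linarith [abs_nonneg x]
  rwa [h4, CStarRing.norm_mul_mem_unitary _ hEp.two_mul_sub_one_mem_unitary]

/-- Iterated halving of the distance by `exists_isStarProjection_norm_sub_le`. -/
theorem mem_of_isSelfAdjoint_of_isClosed {M : VonNeumannAlgebra H} (V : Submodule ℝ (H →L[ℂ] H))
    (hV : IsClosed (V : Set (H →L[ℂ] H))) (hproj : ∀ E ∈ M, IsStarProjection E → E ∈ V)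
    {T : H →L[ℂ] H} (hT : T ∈ M) (hsa : IsSelfAdjoint T) : T ∈ V := by
  have key : ∀ n : ℕ, ∀ T ∈ M, IsSelfAdjoint T → ∃ S ∈ V, ‖T - S‖ ≤ ‖T‖ * (1 / 2) ^ n := by
    intro n
    induction n with
    | zero => exact fun T _ _ => ⟨0, V.zero_mem, by simp⟩
    | succ n ih =>
      intro T hT hsa
      obtain ⟨E, hEM, hE, hle⟩ := exists_isStarProjection_norm_sub_le hT hsa le_rfl
      set U := (‖T‖ / 2) • (2 * E - 1) with hU
      have h1 : (1 : H →L[ℂ] H) ∈ V := hproj 1 (one_mem M) (.one _)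
      have hUV : U ∈ V := by
        refine V.smul_mem _ (V.sub_mem ?_ h1)
        rw [two_mul]
        exact V.add_mem (hproj E hEM hE) (hproj E hEM hE)
      have hUM : U ∈ M := by
        have : (2 * E - 1 : H →L[ℂ] H) ∈ M := by
          rw [two_mul]
          exact sub_mem (add_mem hEM hEM) (one_mem M)
        exact real_smul_mem M _ this
      have hUsa : IsSelfAdjoint U := by
        have : IsSelfAdjoint (2 * E - 1 : H →L[ℂ] H) := by
          rw [two_mul]
          exact (hE.isSelfAdjoint.add hE.isSelfAdjoint).sub (.one _)
        exact (IsSelfAdjoint.all (‖T‖ / 2)).smul this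
      obtain ⟨S, hS, hle'⟩ := ih (T - U) (sub_mem hT hUM) (hsa.sub hUsa)
      refine ⟨U + S, V.add_mem hUV hS, ?_⟩
      have hU_le : ‖T - U‖ * (1 / 2) ^ n ≤ ‖T‖ / 2 * (1 / 2) ^ n :=
        mul_le_mul_of_nonneg_right hle (by positivity)
      have hsplit : T - (U + S) = T - U - S := (sub_sub T U S).symm
      rw [hsplit]
      exact (hle'.trans hU_le).trans_eq (by ring)
  rw [← SetLike.mem_coe, ← hV.closure_eq, Metric.mem_closure_iff]
  intro ε hε
  have hlim : Filter.Tendsto (fun n : ℕ => ‖T‖ * (1 / 2 : ℝ) ^ n) Filter.atTop (nhds 0) := by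
    simpa using (tendsto_pow_atTop_nhds_zero_of_lt_one (r := (1 / 2 : ℝ)) (by norm_num)
      (by norm_num)).const_mul ‖T‖
  obtain ⟨n, hn⟩ := (hlim.eventually (gt_mem_nhds hε)).exists
  obtain ⟨S, hS, hle⟩ := key n T hT hsa
  exact ⟨S, hS, by rw [dist_eq_norm]; exact hle.trans_lt hn⟩

/-! ### Algebras without an abelian summand -/

/-- The vectors killed by all `[P, T]`, `P` a projection and `T` an arbitrary element of `M`. -/
def projectionCommutatorKer (M : VonNeumannAlgebra H) : Submodule ℂ H where
  carrier := {ξ | ∀ P ∈ M, IsStarProjection P → ∀ T ∈ M, (P * T - T * P) ξ = 0}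
  zero_mem' := by simp
  add_mem' {ξ η} hξ hη P hP hP' T hT := by
    rw [map_add, hξ P hP hP' T hT, hη P hP hP' T hT, add_zero]
  smul_mem' c ξ hξ P hP hP' T hT := by rw [map_smul, hξ P hP hP' T hT, smul_zero]

theorem isClosed_projectionCommutatorKer (M : VonNeumannAlgebra H) :
    IsClosed (projectionCommutatorKer M : Set H) := by
  have : (projectionCommutatorKer M : Set H) =
      ⋂ P ∈ M, ⋂ (_ : IsStarProjection P), ⋂ T ∈ M, {ξ | (P * T - T * P) ξ = 0} := by
    ext ξ
    simp only [Set.mem_iInter]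
    rfl
  rw [this]
  refine isClosed_biInter fun P _ => isClosed_iInter fun _ => isClosed_biInter fun T _ => ?_
  exact isClosed_eq (P * T - T * P).continuous continuous_const

/-- `M` leaves the subspace invariant because `[P, T] R = [P, T R] - T [P, R]`. -/
theorem apply_mem_projectionCommutatorKer {M : VonNeumannAlgebra H} {R : H →L[ℂ] H} (hR : R ∈ M)
    {ξ : H} (hξ : ξ ∈ projectionCommutatorKer M) : R ξ ∈ projectionCommutatorKer M := by
  intro P hP hP' T hT
  have h1 := hξ P hP hP' (T * R) (mul_mem hT hR)
  have h2 := hξ P hP hP' R hR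
  have h3 : (P * T - T * P) * R = (P * (T * R) - T * R * P) - T * (P * R - R * P) := by
    noncomm_ring
  change ((P * T - T * P) * R) ξ = 0
  rw [h3]
  change (P * (T * R) - T * R * P) ξ - T ((P * R - R * P) ξ) = 0
  rw [h1, h2, map_zero, sub_zero]

theorem commutant_apply_mem_projectionCommutatorKer {M : VonNeumannAlgebra H} {C : H →L[ℂ] H}
    (hC : C ∈ M.commutant) {ξ : H} (hξ : ξ ∈ projectionCommutatorKer M) :
    C ξ ∈ projectionCommutatorKer M := by
  intro P hP hP' T hT
  have hcomm : Commute C (P * T - T * P) :=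
    commute_of_mem_commutant hC (sub_mem (mul_mem hP hT) (mul_mem hT hP))
  change ((P * T - T * P) * C) ξ = 0
  rw [← hcomm.eq]
  change C ((P * T - T * P) ξ) = 0
  rw [hξ P hP hP' T hT, map_zero]

/-- On the vectors killed by all `[P, T]` the whole algebra commutes, since projections generate. -/
theorem commutator_apply_eq_zero {M : VonNeumannAlgebra H} {S T : H →L[ℂ] H} (hS : S ∈ M)
    (hT : T ∈ M) {ξ : H} (hξ : ξ ∈ projectionCommutatorKer M) : (S * T - T * S) ξ = 0 := by
  let L : (H →L[ℂ] H) →L[ℂ] H :=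
    (ContinuousLinearMap.apply ℂ H ξ).comp
      ((ContinuousLinearMap.mul ℂ (H →L[ℂ] H)).flip T - ContinuousLinearMap.mul ℂ (H →L[ℂ] H) T)
  have hL : ∀ X, L X = (X * T - T * X) ξ := fun X => rfl
  have hsa : ∀ X ∈ M, IsSelfAdjoint X → L X = 0 := fun X hX hX' =>
    mem_of_isSelfAdjoint_of_isClosed (M := M) (LinearMap.ker (L.restrictScalars ℝ).toLinearMap)
      (L.restrictScalars ℝ).isClosed_ker (fun E hE hE' => hξ E hE hE' T hT) hX hX'
  have hre : ((realPart S : selfAdjoint (H →L[ℂ] H)) : H →L[ℂ] H) ∈ M := by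
    rw [realPart_apply_coe]
    exact real_smul_mem M _ (add_mem hS (star_mem hS))
  have him : ((imaginaryPart S : selfAdjoint (H →L[ℂ] H)) : H →L[ℂ] H) ∈ M := by
    rw [imaginaryPart_apply_coe]
    refine smul_mem M _ ?_
    exact real_smul_mem M _ (sub_mem hS (star_mem hS))
  rw [← hL, ← realPart_add_I_smul_imaginaryPart S, map_add, map_smul,
    hsa _ hre (realPart S).2, hsa _ him (imaginaryPart S).2]
  simp

theorem projectionCommutatorKer_eq_bot {M : VonNeumannAlgebra H} (hM : ¬ HasTypeISummand M 1) :
    projectionCommutatorKer M = ⊥ := by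
  set K := projectionCommutatorKer M with hK
  have : CompleteSpace K := (isClosed_projectionCommutatorKer M).completeSpace_coe
  have hZM : K.starProjection ∈ M :=
    starProjection_mem K fun C hC ξ hξ => commutant_apply_mem_projectionCommutatorKer hC hξ
  have hZM' : K.starProjection ∈ M.commutant :=
    starProjection_mem K fun C hC ξ hξ =>
      apply_mem_projectionCommutatorKer (by rwa [commutant_commutant] at hC) hξ
  have hZp : IsStarProjection K.starProjection := isStarProjection_starProjection
  have hcen : ∀ T ∈ M, Commute K.starProjection T := fun T hT => commute_of_mem_commutant hZM' hT
  have habel : ∀ S ∈ M, ∀ T ∈ M, (S * T - T * S) * K.starProjection = 0 := by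
    intro S hS T hT
    ext ξ
    exact commutator_apply_eq_zero hS hT (Submodule.starProjection_apply_mem K ξ)
  let Z : M := ⟨K.starProjection, hZM⟩
  have hZ : IsStarProjection Z :=
    ⟨Subtype.ext hZp.isIdempotentElem, Subtype.ext hZp.isSelfAdjoint⟩
  by_contra hne
  refine hM ⟨Z, hZ, ?_, ?_, fun _ => Z, fun _ => ⟨hZ, fun A B => ?_⟩, ?_, ?_, by simp⟩
  · rw [Semigroup.mem_center_iff]
    exact fun T => Subtype.ext (hcen T T.2).eq.symm
  · intro h0
    apply hne
    have : K.starProjection = 0 := congrArg Subtype.val h0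
    rw [← Submodule.range_starProjection K, this]
    ext; simp
  · have h1 : Z * A * Z * (Z * B * Z) - Z * B * Z * (Z * A * Z) = (A * B - B * A) * Z := by
      have hc : ∀ T : M, Z * T = T * Z := fun T => Subtype.ext (hcen T T.2).eq
      have hzz : Z * Z = Z := hZ.isIdempotentElem
      have hzt : ∀ T : M, Z * T * Z = T * Z := fun T => by rw [hc, mul_assoc, hzz]
      have hab : ∀ S T : M, S * Z * (T * Z) = S * T * Z := fun S T => by
        rw [mul_assoc, ← mul_assoc Z, hzt, mul_assoc]
      rw [hzt, hzt, hab, hab, sub_mul]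
    refine sub_eq_zero.mp (h1.trans (Subtype.ext ?_))
    exact habel A A.2 B B.2
  · intro i j hij
    exact absurd (Subsingleton.elim i j) hij
  · intro i j
    exact ⟨Z, by rw [hZ.isSelfAdjoint.star_eq, hZ.isIdempotentElem.eq],
      by rw [hZ.isSelfAdjoint.star_eq, hZ.isIdempotentElem.eq]⟩

/-- Every commutator `[P, T]` is a difference of two off-diagonal corners, so such a `D` has its
range inside `projectionCommutatorKer M`. -/
theorem eq_zero_of_corner_mul_eq_zero {M : VonNeumannAlgebra H} (hM : ¬ HasTypeISummand M 1)
    (D : M) (hD : ∀ P X : M, IsStarProjection P → P * X = X → X * P = 0 → X * D = 0) : D = 0 := by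
  apply Subtype.ext
  ext ξ
  have hmem : (D : H →L[ℂ] H) ξ ∈ projectionCommutatorKer M := by
    intro P' hP' hPp' T' hT'
    let P : M := ⟨P', hP'⟩
    let T : M := ⟨T', hT'⟩
    have hP : IsStarProjection P :=
      ⟨Subtype.ext hPp'.isIdempotentElem, Subtype.ext hPp'.isSelfAdjoint⟩
    have hPP : P * P = P := hP.isIdempotentElem
    have h1 : P * T * (1 - P) * D = 0 :=
      hD P _ hP (by rw [← mul_assoc, ← mul_assoc, hPP]) (by rw [mul_assoc, sub_mul, hPP]; simp)
    have h2 : (1 - P) * T * P * D = 0 :=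
      hD (1 - P) _ hP.one_sub (by rw [← mul_assoc, ← mul_assoc, hP.one_sub.isIdempotentElem.eq])
        (by rw [mul_assoc, mul_sub, hPP]; simp)
    have h3 : (P * T - T * P) * D = 0 := by
      have : (P * T - T * P) * D = P * T * (1 - P) * D - (1 - P) * T * P * D := by noncomm_ring
      rw [this, h1, h2, sub_zero]
    exact congr(($h3 : H →L[ℂ] H) ξ)
  rw [projectionCommutatorKer_eq_bot hM] at hmem
  simpa using! hmem

/-! ### Ortho-additive range-expansive bijections -/

/-- The inverse of `Φ` shrinks range projections, hence preserves orthogonality and is again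
ortho-additive; applied to `A = P A + (1 - P) A` this shows that it commutes with left
multiplication by `P`. -/
theorem mem_leftMultipliers_of_isStarProjection {M : VonNeumannAlgebra H} {Φ : M → M}
    (hadd : IsOrthoAdditive Φ) (hexp : IsRangeExpansive Φ) (hbij : Function.Bijective Φ) {P : M}
    (hP : IsStarProjection P) : P ∈ leftMultipliers Φ := by
  have hker : ∀ B A : M, B * Φ A = 0 → B * A = 0 := fun B A h => by
    have := mul_eq_zero_of_rangeProj_le (B := (B : H →L[ℂ] H)) (hexp A) (congrArg Subtype.val h)
    exact Subtype.ext this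
  have hPP : P * P = P := hP.isIdempotentElem
  intro A
  obtain ⟨A₁, h₁⟩ := hbij.surjective (P * Φ A)
  obtain ⟨A₂, h₂⟩ := hbij.surjective ((1 - P) * Φ A)
  have e₁ : (1 - P) * A₁ = 0 := hker _ _ (by rw [h₁, ← mul_assoc, sub_mul, hPP]; simp)
  have e₂ : P * A₂ = 0 := hker _ _ (by rw [h₂, ← mul_assoc, mul_sub, hPP]; simp)
  have e₁' : P * A₁ = A₁ := by
    rw [sub_mul, one_mul, sub_eq_zero] at e₁
    exact e₁.symm
  have hortho : Ortho A₁ A₂ := by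
    unfold Ortho
    rw [← e₁', star_mul, hP.isSelfAdjoint.star_eq, mul_assoc, e₂, mul_zero]
  have hsum : A₁ + A₂ = A := hbij.injective (by
    rw [hadd _ _ hortho, h₁, h₂, ← add_mul, add_sub_cancel, one_mul])
  rw [← hsum, mul_add, e₁', e₂, add_zero, hsum, h₁]

end VonNeumannAlgebra

theorem corollary3p7 {H : Type*} [NormedAddCommGroup H] [InnerProductSpace ℂ H] [CompleteSpace H]
    (M : VonNeumannAlgebra H) (hM : ¬ VonNeumannAlgebra.HasTypeISummand M 1)
    (Φ : M → M) (hadd : VonNeumannAlgebra.IsOrthoAdditive Φ)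
    (hexp : VonNeumannAlgebra.IsRangeExpansive Φ) (hbij : Function.Bijective Φ) :
    (∀ A : M, Φ A = A * Φ 1) ∧ IsUnit (Φ 1) := by
  have hunit : ∀ X : M, IsUnit (1 + X * star X) := VonNeumannAlgebra.isUnit_one_add_mul_star
  have hcorner := VonNeumannAlgebra.eq_zero_of_corner_mul_eq_zero hM
  have hproj : ∀ P : M, IsStarProjection P → P ∈ leftMultipliers Φ := fun _ hP =>
    VonNeumannAlgebra.mem_leftMultipliers_of_isStarProjection hadd hexp hbij hP
  have hΦ : ∀ A : M, Φ A = A * Φ 1 := by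
    intro A
    exact eq_mul_map_one_of_isStarProjection_mem_leftMultipliers hunit hcorner hproj A
  refine ⟨hΦ, ?_⟩
  obtain ⟨B, hB⟩ := hbij.surjective 1
  have hB1 : B * Φ 1 = 1 := by rw [← hΦ, hB]
  -- The left inverse `B` is a right inverse: `Φ` takes the same value at `Φ 1 * B` and at `1`.
  have h1B : Φ 1 * B = 1 := hbij.injective (by
    rw [hΦ (Φ 1 * B), mul_assoc, hB1, mul_one])
  exact ⟨⟨Φ 1, B, h1B, hB1⟩, rfl⟩
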